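/- Let $G$ be a finite weighted multigraph with vertex set $V$, without loops (multiple edges are allowed), all of whose edge weights are strictly positive. Let $L=(\ell_{ij})$ be its Laplacian matrix: for $i\ne j$, $-\ell_{ij}$ is the sum of the weights of all edges between $i$ and $j$, and $\ell_{ii}=-\sum_{j\neq i}\ell_{ij}$. Let $\alpha>0$, let $Q=(q_{ij})=(I+\alpha L)^{-1}$, and let $$d_{ij}=\tfrac12\,(q_{ii}+q_{jj}-q_{ij}-q_{ji})$$ be the forest distance between the vertices $i$ and $j$. Let $G_\alpha$ be the weighted multigraph obtained from $G$ by multiplying all edge weights by $\alpha$. A spanning rooted forest of $G_\alpha$ is an acyclic spanning subgraph of $G_\alpha$ with exactly one vertex marked as a root in each of its components (trees); its weight $\varepsilon(F)$ is the product of the weights (in $G_\alpha$) of its edges. Such a forest is an unsuccessful connection from $u$ to $v$ if $u$ is a root and $v$ does not belong to the tree rooted at $u$. Let $i,j\in V$ and consider the following random experiment: choose one of $i$, $j$ with probability $1/2$ each and, independently, choose a spanning rooted forest $F$ of $G_\alpha$ with probability $\varepsilon(F)/\sum_{F'}\varepsilon(F')$, where the sum is over all spanning rooted forests $F'$ of $G_\alpha$.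 Then $d_{ij}$ is equal to the probability that $F$ is an unsuccessful connection from the chosen vertex to the other vertex of the pair $(i,j)$. -/

import Mathlib

/-- A loopless weighted multigraph with vertex type `V` and edge type `E`: every edge has an
unordered pair of distinct end vertices and a strictly positive weight.  Several edges may have
the same ends. -/
structure WeightedMultigraph (V E : Type*) where
  /-- the unordered pair of ends of an edge -/
  ends : E → Sym2 V
  /-- the weight of an edge -/
  weight : E → ℝ
  not_isDiag_ends : ∀ e, ¬ (ends e).IsDiag
  weight_pos : ∀ e, 0 < weight e

namespace WeightedMultigraph

section Basic

variable {V E : Type*}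

/-- The weighted multigraph `G_α` obtained from `G` by multiplying all weights by `α > 0`. -/
def scale (G : WeightedMultigraph V E) (α : ℝ) (hα : 0 < α) : WeightedMultigraph V E where
  ends := G.ends
  weight e := α * G.weight e
  not_isDiag_ends := G.not_isDiag_ends
  weight_pos e := mul_pos hα (G.weight_pos e)

/-- The simple graph on `V` in which two vertices are adjacent when some edge in `F` joins them.
It has the same connected components as the spanning subgraph of `G` with edge set `F`. -/
def support (G : WeightedMultigraph V E) (F : Finset E) : SimpleGraph V :=
  SimpleGraph.fromEdgeSet {s | ∃ e ∈ F, G.ends e = s}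

/-- The spanning subgraph of `G` with edge set `F` has no cycle: it has no two parallel edges
(a cycle of length two), and no cycle of length at least three. -/
def IsAcyclic (G : WeightedMultigraph V E) (F : Finset E) : Prop :=
  Set.InjOn G.ends (F : Set E) ∧ (G.support F).IsAcyclic

/-- A spanning rooted forest of `G`: an acyclic set of edges (all vertices of `G` are vertices of
the forest), and a set of vertices, the roots, that has exactly one member in each component. -/
@[ext]
structure SpanningRootedForest (G : WeightedMultigraph V E) where
  edges : Finset E
  roots : Finset V
  isAcyclic : G.IsAcyclic edges
  existsUnique_root : ∀ c : (G.support edges).ConnectedComponent,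
    ∃! r, r ∈ roots ∧ (G.support edges).connectedComponentMk r = c

namespace SpanningRootedForest

variable {G : WeightedMultigraph V E}

/-- The weight of a forest: the product of the weights of its edges. -/
def weight (F : G.SpanningRootedForest) : ℝ := ∏ e ∈ F.edges, G.weight e

/-- `F` is an unsuccessful connection from `i` to `j`: `i` is a root, and `j` does not belong to
the tree (component) of `i`. -/
def IsUnsuccessful (F : G.SpanningRootedForest) (i j : V) : Prop :=
  i ∈ F.roots ∧ ¬ (G.support F.edges).Reachable i j

lemma weight_pos (F : G.SpanningRootedForest) : 0 < F.weight :=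
  Finset.prod_pos fun e _ => G.weight_pos e

noncomputable instance [Fintype V] [Fintype E] : Fintype G.SpanningRootedForest :=
  Fintype.ofInjective (fun F => (F.edges, F.roots)) fun F F' h => by
    simp only [Prod.mk.injEq] at h
    exact SpanningRootedForest.ext h.1 h.2

/-- The edgeless forest, in which every vertex is a root. -/
instance [Fintype V] : Nonempty G.SpanningRootedForest := by
  have h : G.support ∅ = ⊥ := by simp [support]
  refine ⟨⟨∅, Finset.univ, ⟨by simp, by rw [h]; exact SimpleGraph.isAcyclic_bot⟩, ?_⟩⟩
  rw [h]
  intro c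
  induction c using SimpleGraph.ConnectedComponent.ind with
  | _ v =>
    refine ⟨v, ⟨Finset.mem_univ v, rfl⟩, fun r hr => ?_⟩
    simpa using hr.2

end SpanningRootedForest

/-- The random spanning rooted forest of `G`: a forest is chosen with probability its weight
divided by the sum of the weights of all spanning rooted forests. -/
noncomputable def randomForest [Fintype V] [Fintype E] (G : WeightedMultigraph V E) :
    PMF G.SpanningRootedForest :=
  PMF.ofFintype
    (fun F => ENNReal.ofReal (F.weight / ∑ F' : G.SpanningRootedForest, F'.weight)) <| by
    have h : 0 < ∑ F' : G.SpanningRootedForest, F'.weight :=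
      Finset.sum_pos (fun F _ => F.weight_pos) Finset.univ_nonempty
    rw [← ENNReal.ofReal_sum_of_nonneg fun F _ => div_nonneg F.weight_pos.le h.le,
      ← Finset.sum_div, div_self h.ne', ENNReal.ofReal_one]

/-- The law of the random connection of `i` and `j` in `G`.  An outcome `(u, v, F)` consists of
the vertex `u` chosen among `i` and `j` by a fair coin, the remaining vertex `v`, and a random
spanning rooted forest `F` chosen independently of the coin. -/
noncomputable def randomConnection [Fintype V] [Fintype E] (G : WeightedMultigraph V E)
    (i j : V) : PMF (V × V × G.SpanningRootedForest) :=
  (PMF.uniformOfFintype Bool).bind fun b =>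
    G.randomForest.map fun F => if b then (i, j, F) else (j, i, F)

/-- The probability that an unsuccessful connection between `i` and `j` is chosen, that is, that
the random forest is an unsuccessful connection from the chosen vertex to the remaining one. -/
noncomputable def probUnsuccessful [Fintype V] [Fintype E] (G : WeightedMultigraph V E)
    (i j : V) : ℝ :=
  ((G.randomConnection i j).toOuterMeasure {ω | ω.2.2.IsUnsuccessful ω.1 ω.2.1}).toReal

end Basic

section Matrices

variable {V E : Type*} [Fintype V] [DecidableEq V] [Fintype E]

/-- The total weight of the edges between `i` and `j`. -/
def edgeWeight (G : WeightedMultigraph V E) (i j : V) : ℝ :=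
  ∑ e with G.ends e = s(i, j), G.weight e

/-- The Laplacian matrix of `G`. -/
def laplacian (G : WeightedMultigraph V E) : Matrix V V ℝ :=
  Matrix.of fun i j =>
    if i = j then ∑ k ∈ Finset.univ.erase i, G.edgeWeight i k else - G.edgeWeight i j

/-- The inverse that defines the relative forest accessibilities exists. -/
lemma isUnit_one_add_smul_laplacian (G : WeightedMultigraph V E) {α : ℝ} (hα : 0 < α) :
    IsUnit (1 + α • G.laplacian) := by
  rw [Matrix.isUnit_iff_isUnit_det, isUnit_iff_ne_zero]
  have hw : ∀ i j, 0 ≤ G.edgeWeight i j := fun i j =>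
    Finset.sum_nonneg fun e _ => (G.weight_pos e).le
  refine det_ne_zero_of_sum_row_lt_diag fun i => ?_
  have h1 : ∀ k ∈ Finset.univ.erase i,
      ‖(1 + α • G.laplacian) i k‖ = α * G.edgeWeight i k := by
    intro k hk
    have hk' : i ≠ k := (Finset.ne_of_mem_erase hk).symm
    simp [laplacian, hk', abs_of_nonneg, hα.le, hw]
  rw [Finset.sum_congr rfl h1, ← Finset.mul_sum]
  have h2 : (1 + α • G.laplacian) i i = 1 + α * ∑ k ∈ Finset.univ.erase i, G.edgeWeight i k := by
    simp [laplacian]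
  rw [h2, Real.norm_eq_abs]
  exact lt_of_lt_of_le (by linarith) (le_abs_self _)

/-- The matrix `Q_α = (I + α L)⁻¹` of relative forest accessibilities. -/
noncomputable def accessibility (G : WeightedMultigraph V E) (α : ℝ) : Matrix V V ℝ :=
  (1 + α • G.laplacian)⁻¹

/-- The forest distance between `i` and `j` with parameter `α`. -/
noncomputable def forestDist (G : WeightedMultigraph V E) (α : ℝ) (i j : V) : ℝ :=
  1 / 2 * (G.accessibility α i i + G.accessibility α j j
    - G.accessibility α i j - G.accessibility α j i)

end Matrices

end WeightedMultigraph

/-! The theorem reduces to the matrix forest theorem: `q i k` is the share, in the total forest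
weight of `G_α`, of the forests in which `k` lies in the tree rooted at `i`. Then `q i i - q i j` is
the probability that `i` is a root and `j` is outside its tree, and averaging over the coin gives
the forest distance.

For the matrix forest theorem, let `A` hold the unnormalised weights and let `σ` be their total over
all forests; the claim is `A * (1 + L) = σ • 1`. Fix a column `j` and group the forests by what
remains when `j` is made a root (`sum_forests`): a group consists of a forest `p` with root `j` and,
for each edge leaving the tree of `j`, the forest in which this tree is attached along that edge.
Attaching along `y` multiplies the weight by that of `y` and gives the tree of `j` the root of the
other end of `y`. So the attached forests add terms linear in the edge weights, which cancel the
off-diagonal terms of `p`, and a double sum over pairs of outgoing edges, which vanishes by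
antisymmetry. What is left is `δ i j` times the weight of the group (`sum_forests_laplacian`). -/

namespace SimpleGraph

/-! ### Reachability and unique paths in acyclic graphs. -/

variable {V : Type*} {H : SimpleGraph V}

/-- Two vertices are connected after adding the edge `ab` when they were connected before, or
become connected through that edge. -/
lemma reachable_sup_edge_iff {a b u v : V} :
    (H ⊔ edge a b).Reachable u v ↔ H.Reachable u v ∨ (H.Reachable u a ∧ H.Reachable b v) ∨
      (H.Reachable u b ∧ H.Reachable a v) := by
  constructor
  · rintro ⟨p⟩
    induction p with
    | nil => exact Or.inl (Reachable.refl _)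
    | @cons x y z h p ih =>
      rcases h with h | h
      · have hxy : H.Reachable x y := h.reachable
        rcases ih with ih | ⟨ih, ih'⟩ | ⟨ih, ih'⟩
        · exact Or.inl (hxy.trans ih)
        · exact Or.inr (Or.inl ⟨hxy.trans ih, ih'⟩)
        · exact Or.inr (Or.inr ⟨hxy.trans ih, ih'⟩)
      · rw [edge_adj] at h
        rcases h.1 with ⟨rfl, rfl⟩ | ⟨rfl, rfl⟩
        · rcases ih with ih | ⟨-, ih⟩ | ⟨-, ih⟩
          · exact Or.inr (Or.inl ⟨Reachable.refl _, ih⟩)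
          · exact Or.inr (Or.inl ⟨Reachable.refl _, ih⟩)
          · exact Or.inl ih
        · rcases ih with ih | ⟨-, ih⟩ | ⟨-, ih⟩
          · exact Or.inr (Or.inr ⟨Reachable.refl _, ih⟩)
          · exact Or.inl ih
          · exact Or.inr (Or.inr ⟨Reachable.refl _, ih⟩)
  · have hle : H ≤ H ⊔ edge a b := le_sup_left
    have hab : (H ⊔ edge a b).Reachable a b := by
      by_cases hne : a = b
      · rw [hne]
      · exact Adj.reachable (Or.inr (by simp [edge_adj, hne]))
    rintro (h | ⟨h, h'⟩ | ⟨h, h'⟩)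
    · exact h.mono hle
    · exact (h.mono hle).trans (hab.trans (h'.mono hle))
    · exact (h.mono hle).trans (hab.symm.trans (h'.mono hle))

/-- A vertex `j` connected to `r ≠ j` has a neighbour that is connected to `r` without the edge
to `j`. -/
lemma Reachable.exists_adj_reachable_deleteEdges {j r : V} (h : H.Reachable j r) (hne : j ≠ r) :
    ∃ m, H.Adj j m ∧ (H.deleteEdges {s(j, m)}).Reachable m r := by
  classical
  obtain ⟨p, hp⟩ := h.exists_isPath
  cases p with
  | nil => exact absurd rfl hne
  | @cons _ m _ hadj q =>
    rw [Walk.cons_isPath_iff] at hp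
    -- The rest of the path cannot use the edge `jm`, since it would return to `j`.
    exact ⟨m, hadj, reachable_deleteEdges_iff_exists_walk.2
      ⟨q, fun hq => hp.2 (q.fst_mem_support_of_mem_edges hq)⟩⟩

/-- In an acyclic graph there is only one neighbour of `j` that is connected to `r` inside a
subgraph in which it is not connected to `j`. -/
lemma IsAcyclic.eq_of_adj_of_reachable {K K' : SimpleGraph V} (hH : H.IsAcyclic) (hK : K ≤ H)
    (hK' : K' ≤ H) {j m m' r : V} (hm : H.Adj j m) (hm' : H.Adj j m') (h : K.Reachable m r)
    (h' : K'.Reachable m' r) (hj : ¬ K.Reachable m j) (hj' : ¬ K'.Reachable m' j) : m = m' := by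
  classical
  have key : ∀ {K : SimpleGraph V} (hK : K ≤ H) {m : V} (hm : H.Adj j m), K.Reachable m r →
      ¬ K.Reachable m j → ∃ q : H.Walk m r, (Walk.cons hm q).IsPath := by
    intro K hK m hm h hj
    obtain ⟨p, hp⟩ := h.exists_isPath
    refine ⟨p.mapLe hK, ?_⟩
    rw [Walk.cons_isPath_iff]
    refine ⟨hp.mapLe hK, fun hmem => hj ?_⟩
    rw [Walk.support_mapLe_eq_support] at hmem
    exact ⟨p.takeUntil j hmem⟩
  obtain ⟨q, hq⟩ := key hK hm h hj
  obtain ⟨q', hq'⟩ := key hK' hm' h' hj'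
  have heq := congrArg Subtype.val ((hH.subsingleton_path j r).elim (⟨_, hq⟩ : H.Path j r) ⟨_, hq'⟩)
  simpa using congrArg Walk.snd heq

end SimpleGraph

namespace WeightedMultigraph

/-! ### Attaching and detaching the tree of a root. -/

section RootedForests

variable {V E : Type*} {G : WeightedMultigraph V E} {S : Finset E} {R : Finset V}

/-- The edge set `S` and the root set `R` form a spanning rooted forest of `G`. -/
structure IsRootedForest (G : WeightedMultigraph V E) (S : Finset E) (R : Finset V) : Prop where
  isAcyclic : G.IsAcyclic S
  exists_root : ∀ v, ∃ r ∈ R, (G.support S).Reachable r v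
  root_unique : ∀ r ∈ R, ∀ r' ∈ R, (G.support S).Reachable r r' → r = r'

lemma SpanningRootedForest.isRootedForest (F : G.SpanningRootedForest) :
    G.IsRootedForest F.edges F.roots where
  isAcyclic := F.isAcyclic
  exists_root v := by
    obtain ⟨r, ⟨hr, h⟩, -⟩ := F.existsUnique_root ((G.support F.edges).connectedComponentMk v)
    exact ⟨r, hr, SimpleGraph.ConnectedComponent.exact h⟩
  root_unique r hr r' hr' h :=
    (F.existsUnique_root ((G.support F.edges).connectedComponentMk r')).unique
      ⟨hr, SimpleGraph.ConnectedComponent.sound h⟩ ⟨hr', rfl⟩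

/-- The spanning rooted forest with edge set `S` and root set `R`. -/
def IsRootedForest.toSpanningRootedForest (h : G.IsRootedForest S R) :
    G.SpanningRootedForest where
  edges := S
  roots := R
  isAcyclic := h.isAcyclic
  existsUnique_root c := by
    induction c using SimpleGraph.ConnectedComponent.ind with
    | _ v =>
      obtain ⟨r, hr, hrv⟩ := h.exists_root v
      refine ⟨r, ⟨hr, SimpleGraph.ConnectedComponent.sound hrv⟩, fun r' hr' => ?_⟩
      exact h.root_unique r' hr'.1 r hr
        ((SimpleGraph.ConnectedComponent.exact hr'.2).trans hrv.symm)

lemma support_adj_of_mem {e : E} {a b : V} (he : e ∈ S) (hab : G.ends e = s(a, b)) :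
    (G.support S).Adj a b := by
  rw [support, SimpleGraph.fromEdgeSet_adj]
  refine ⟨⟨e, he, hab⟩, fun h => G.not_isDiag_ends e ?_⟩
  rw [hab, h]
  exact Sym2.mk_isDiag_iff.2 rfl

variable [DecidableEq E]

lemma support_insert {e : E} {a b : V} (hab : G.ends e = s(a, b)) :
    G.support (insert e S) = G.support S ⊔ SimpleGraph.edge a b := by
  rw [support, support, SimpleGraph.edge, ← SimpleGraph.fromEdgeSet_union]
  congr 1
  ext s
  simp [hab, eq_comm]

lemma support_erase {e : E} {a b : V} (he : e ∈ S) (hS : Set.InjOn G.ends (S : Set E))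
    (hab : G.ends e = s(a, b)) :
    G.support (S.erase e) = (G.support S).deleteEdges {s(a, b)} := by
  ext u v
  simp only [support, SimpleGraph.fromEdgeSet_adj, SimpleGraph.deleteEdges_adj, Set.mem_ofPred_eq,
    Finset.mem_erase, Set.mem_singleton_iff]
  constructor
  · rintro ⟨⟨f, ⟨hne, hf⟩, hfe⟩, huv⟩
    exact ⟨⟨⟨f, hf, hfe⟩, huv⟩, fun h => hne (hS hf he (by rw [hfe, h, hab]))⟩
  · rintro ⟨⟨⟨f, hf, hfe⟩, huv⟩, hne⟩
    exact ⟨⟨f, ⟨fun h => hne (by rw [← hfe, h, hab]), hf⟩, hfe⟩, huv⟩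

variable [DecidableEq V]

/-- Attaching the tree rooted at `j` to a vertex `m` of another tree. -/
lemma IsRootedForest.insert_erase (h : G.IsRootedForest S R) {j m : V} {e : E} (hj : j ∈ R)
    (he : G.ends e = s(j, m)) (hm : ¬ (G.support S).Reachable j m) :
    G.IsRootedForest (insert e S) (R.erase j) where
  isAcyclic := by
    have heS : ∀ f ∈ S, G.ends f ≠ s(j, m) := fun f hf hfe =>
      hm (support_adj_of_mem hf hfe).reachable
    refine ⟨?_, ?_⟩
    · rw [Finset.coe_insert, Set.injOn_insert (fun hS => heS e hS he)]
      refine ⟨h.isAcyclic.1, ?_⟩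
      rintro ⟨f, hf, hfe⟩
      exact heS f hf (hfe.trans he)
    · rw [support_insert he]
      exact h.isAcyclic.2.sup_edge_of_not_reachable hm
  exists_root v := by
    rw [support_insert he]
    by_cases hv : (G.support S).Reachable j v
    · obtain ⟨r, hr, hrm⟩ := h.exists_root m
      refine ⟨r, Finset.mem_erase.2 ⟨fun hrj => hm (hrj ▸ hrm), hr⟩, ?_⟩
      exact SimpleGraph.reachable_sup_edge_iff.2 (Or.inr (Or.inr ⟨hrm, hv⟩))
    · obtain ⟨r, hr, hrv⟩ := h.exists_root v
      exact ⟨r, Finset.mem_erase.2 ⟨fun hrj => hv (hrj ▸ hrv), hr⟩,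
        SimpleGraph.reachable_sup_edge_iff.2 (Or.inl hrv)⟩
  root_unique r hr r' hr' hrr' := by
    rw [Finset.mem_erase] at hr hr'
    rw [support_insert he, SimpleGraph.reachable_sup_edge_iff] at hrr'
    rcases hrr' with hrr' | ⟨hrr', -⟩ | ⟨-, hrr'⟩
    · exact h.root_unique r hr.2 r' hr'.2 hrr'
    · exact absurd (h.root_unique r hr.2 j hj hrr') hr.1
    · exact absurd (h.root_unique j hj r' hr'.2 hrr').symm hr'.1

/-- The root of a vertex after attaching the tree of `j` to the vertex `m`. -/
lemma IsRootedForest.mem_erase_and_reachable_insert_iff (h : G.IsRootedForest S R) {i j m k : V}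
    {e : E} (hj : j ∈ R) (he : G.ends e = s(j, m)) (hm : ¬ (G.support S).Reachable j m) :
    i ∈ R.erase j ∧ (G.support (insert e S)).Reachable i k ↔
      i ∈ R ∧ (((G.support S).Reachable j k ∧ (G.support S).Reachable i m) ∨
        (¬ (G.support S).Reachable j k ∧ (G.support S).Reachable i k)) := by
  rw [support_insert he, SimpleGraph.reachable_sup_edge_iff, Finset.mem_erase]
  by_cases hij : i = j
  · subst hij
    simp [hm]
  · by_cases hi : i ∈ R
    · have hij' : ¬ (G.support S).Reachable i j := fun h' => hij (h.root_unique i hi j hj h')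
      have hik : (G.support S).Reachable j k → ¬ (G.support S).Reachable i k :=
        fun h₁ h₂ => hij' (h₂.trans h₁.symm)
      tauto
    · simp [hi]

/-- Every forest in which `j` is not a root arises by attaching the tree rooted at `j`. -/
lemma IsRootedForest.exists_eq_insert_erase (h : G.IsRootedForest S R) {j : V} (hj : j ∉ R) :
    ∃ (e : E) (m : V), e ∈ S ∧ G.ends e = s(j, m) ∧
      G.IsRootedForest (S.erase e) (insert j R) ∧ ¬ (G.support (S.erase e)).Reachable j m := by
  -- The edge to remove is the first one on the path from `j` to its root `r`.
  obtain ⟨r, hr, hrj⟩ := h.exists_root j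
  obtain ⟨m, hadj, hmr⟩ := hrj.symm.exists_adj_reachable_deleteEdges
    (fun hjr => hj (hjr ▸ hr))
  obtain ⟨⟨e, he, hends⟩, -⟩ := (SimpleGraph.fromEdgeSet_adj _).1 hadj
  have hbridge : ¬ ((G.support S).deleteEdges {s(j, m)}).Reachable j m :=
    SimpleGraph.isBridge_iff.1
      (SimpleGraph.isAcyclic_iff_forall_isBridge.1 h.isAcyclic.2 (e := s(j, m)) hadj)
  rw [← support_erase he h.isAcyclic.1 hends] at hmr hbridge
  have hS : G.support S = G.support (S.erase e) ⊔ SimpleGraph.edge j m := by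
    rw [← support_insert hends, Finset.insert_erase he]
  have hle : G.support (S.erase e) ≤ G.support S := hS ▸ le_sup_left
  -- Such an `r'` would equal `r`, which is still joined to `m`; this would link `j` to `m` without
  -- the bridge.
  have hroot : ∀ r' ∈ R, ¬ (G.support (S.erase e)).Reachable r' j := by
    intro r' hr' hr'j
    have := h.root_unique r' hr' r hr ((hr'j.mono hle).trans hrj.symm)
    exact hbridge (hr'j.symm.trans (this ▸ hmr.symm))
  refine ⟨e, m, he, hends, ⟨⟨h.isAcyclic.1.mono (by simp), h.isAcyclic.2.anti hle⟩,
    fun v => ?_, fun r₁ h₁ r₂ h₂ h₁₂ => ?_⟩, hbridge⟩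
  · obtain ⟨r', hr', hv⟩ := h.exists_root v
    rw [hS, SimpleGraph.reachable_sup_edge_iff] at hv
    rcases hv with hv | ⟨hv, -⟩ | ⟨-, hv⟩
    · exact ⟨r', Finset.mem_insert_of_mem hr', hv⟩
    · exact absurd hv (hroot r' hr')
    · exact ⟨j, Finset.mem_insert_self _ _, hv⟩
  · rw [Finset.mem_insert] at h₁ h₂
    rcases h₁ with rfl | h₁ <;> rcases h₂ with rfl | h₂
    · rfl
    · exact absurd h₁₂.symm (hroot r₂ h₂)
    · exact absurd h₁₂ (hroot r₁ h₁)
    · exact h.root_unique r₁ h₁ r₂ h₂ (h₁₂.mono hle)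

/-- The edge by which the tree rooted at `j` was attached can be recovered from the result. -/
lemma IsRootedForest.insert_erase_injective {S' : Finset E} {R' : Finset V}
    (h : G.IsRootedForest S R) (h' : G.IsRootedForest S' R') {j m m' : V} {e e' : E}
    (hj : j ∈ R) (hj' : j ∈ R') (he : G.ends e = s(j, m)) (he' : G.ends e' = s(j, m'))
    (hm : ¬ (G.support S).Reachable j m) (hm' : ¬ (G.support S').Reachable j m')
    (hS : insert e S = insert e' S') (hR : R.erase j = R'.erase j) :
    S = S' ∧ R = R' ∧ m = m' ∧ e = e' := by
  have hRR : R = R' := by rw [← Finset.insert_erase hj, hR, Finset.insert_erase hj']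
  have hT := h.insert_erase hj he hm
  have hle : G.support S ≤ G.support (insert e S) := support_insert he ▸ le_sup_left
  have hle' : G.support S' ≤ G.support (insert e S) :=
    hS ▸ support_insert (S := S') he' ▸ le_sup_left
  have hadj : (G.support (insert e S)).Adj j m :=
    support_adj_of_mem (Finset.mem_insert_self _ _) he
  have hadj' : (G.support (insert e S)).Adj j m' :=
    support_adj_of_mem (hS ▸ Finset.mem_insert_self _ _) he'
  obtain ⟨r, hr, hrm⟩ := h.exists_root m
  obtain ⟨r', hr', hrm'⟩ := h'.exists_root m'
  -- Both `m` and `m'` are adjacent to `j` in the common result, so their roots lie in one tree.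
  -- Hence `m` and `m'` are both the first step from `j` towards that root.
  have hrr : r = r' := by
    refine hT.root_unique r (Finset.mem_erase.2 ⟨fun hrj => hm (hrj ▸ hrm), hr⟩) r'
      (hR ▸ Finset.mem_erase.2 ⟨fun hrj => hm' (hrj ▸ hrm'), hr'⟩) ?_
    exact (hrm.mono hle).trans (hadj.reachable.symm.trans
      (hadj'.reachable.trans (hrm'.mono hle').symm))
  subst hrr
  have hmm : m = m' := hT.isAcyclic.2.eq_of_adj_of_reachable hle hle' hadj hadj' hrm.symm
    hrm'.symm (fun h => hm h.symm) (fun h => hm' h.symm)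
  have hee : e = e' := hT.isAcyclic.1 (Finset.mem_coe.2 (Finset.mem_insert_self _ _))
    (Finset.mem_coe.2 (hS ▸ Finset.mem_insert_self _ _)) (by rw [he, he', hmm])
  refine ⟨?_, hRR, hmm, hee⟩
  subst hee
  have h₁ : e ∉ S := fun heS => hm (support_adj_of_mem heS he).reachable
  have h₂ : e ∉ S' := fun heS => hm' (support_adj_of_mem heS he').reachable
  rw [← Finset.erase_insert h₁, hS, Finset.erase_insert h₂]

end RootedForests

/-! ### Weighted sums over forests. -/

section ForestSums

variable {V E : Type*}

open scoped Classical in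
/-- The indicator of `k` belonging to the tree rooted at `i`. -/
noncomputable def treeIndicator (G : WeightedMultigraph V E) (p : Finset E × Finset V)
    (i k : V) : ℝ :=
  if i ∈ p.2 ∧ (G.support p.1).Reachable i k then 1 else 0

lemma treeIndicator_root [DecidableEq V] {G : WeightedMultigraph V E} {p : Finset E × Finset V}
    (hp : G.IsRootedForest p.1 p.2) {i j : V} (hj : j ∈ p.2) :
    G.treeIndicator p i j = if i = j then 1 else 0 := by
  rw [treeIndicator]
  congr 1
  exact propext ⟨fun h => hp.root_unique i h.1 j hj h.2,
    fun h => by subst h; exact ⟨hj, SimpleGraph.Reachable.refl _⟩⟩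

lemma treeIndicator_congr {G : WeightedMultigraph V E} {p : Finset E × Finset V} {i j k : V}
    (h : (G.support p.1).Reachable j k) : G.treeIndicator p i k = G.treeIndicator p i j := by
  rw [treeIndicator, treeIndicator]
  congr 2
  exact propext ⟨fun h' => h'.trans h.symm, fun h' => h'.trans h⟩

variable [Fintype V] [Fintype E]

open scoped Classical in
/-- The spanning rooted forests of `G`, as pairs of an edge set and a root set. -/
noncomputable def forests (G : WeightedMultigraph V E) : Finset (Finset E × Finset V) :=
  Finset.univ.filter fun p => G.IsRootedForest p.1 p.2

open scoped Classical in
/-- The edges from `j` to a vertex outside the component of `j` in the spanning subgraph with edge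
set `S`, paired with their other end. -/
noncomputable def outgoing (G : WeightedMultigraph V E) (S : Finset E) (j : V) : Finset (V × E) :=
  Finset.univ.filter fun x => G.ends x.2 = s(j, x.1) ∧ ¬ (G.support S).Reachable j x.1

variable {G : WeightedMultigraph V E}

lemma mem_forests {p : Finset E × Finset V} :
    p ∈ G.forests ↔ G.IsRootedForest p.1 p.2 := by
  simp [forests]

lemma mem_outgoing {S : Finset E} {j : V} {x : V × E} :
    x ∈ G.outgoing S j ↔ G.ends x.2 = s(j, x.1) ∧ ¬ (G.support S).Reachable j x.1 := by
  simp [outgoing]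

lemma sum_spanningRootedForest (f : Finset E × Finset V → ℝ) :
    ∑ F : G.SpanningRootedForest, f (F.edges, F.roots) = ∑ p ∈ G.forests, f p :=
  Finset.sum_bij (fun F _ => (F.edges, F.roots))
    (fun F _ => mem_forests.2 F.isRootedForest)
    (fun _ _ _ _ h => SpanningRootedForest.ext (congrArg Prod.fst h) (congrArg Prod.snd h))
    (fun _ hp => ⟨(mem_forests.1 hp).toSpanningRootedForest, Finset.mem_univ _, rfl⟩)
    (fun _ _ => rfl)

lemma sum_weight_pos : 0 < ∑ F : G.SpanningRootedForest, F.weight :=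
  Finset.sum_pos (fun F _ => F.weight_pos) Finset.univ_nonempty

lemma sum_weight_eq : ∑ F : G.SpanningRootedForest, F.weight =
    ∑ p ∈ G.forests, ∏ e ∈ p.1, G.weight e :=
  sum_spanningRootedForest (fun p => ∏ e ∈ p.1, G.weight e)

lemma probUnsuccessful_eq (i j : V) :
    G.probUnsuccessful i j = 1 / 2 *
      ((G.randomForest.toOuterMeasure {F | F.IsUnsuccessful i j}).toReal +
        (G.randomForest.toOuterMeasure {F | F.IsUnsuccessful j i}).toReal) := by
  -- `ENNReal.toReal` is additive only on finite values.
  have hfin : ∀ s : Set G.SpanningRootedForest, G.randomForest.toOuterMeasure s ≠ ⊤ := fun s =>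
    ne_top_of_le_ne_top ENNReal.one_ne_top (by
      rw [PMF.toOuterMeasure_apply, ← G.randomForest.tsum_coe]
      exact ENNReal.tsum_le_tsum fun F => Set.indicator_le_self _ _ F)
  rw [probUnsuccessful, randomConnection, PMF.toOuterMeasure_bind_apply, tsum_bool,
    PMF.toOuterMeasure_map_apply, PMF.toOuterMeasure_map_apply,
    ENNReal.toReal_add (ENNReal.mul_ne_top (PMF.apply_ne_top _ _) (hfin _))
      (ENNReal.mul_ne_top (PMF.apply_ne_top _ _) (hfin _)),
    ENNReal.toReal_mul, ENNReal.toReal_mul]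
  simp only [PMF.uniformOfFintype_apply, Fintype.card_bool, ENNReal.toReal_inv,
    Set.preimage_ofPred_eq]
  simp
  ring

variable [DecidableEq V]

/-- Over all edges at `j`, only those that leave the component of `j` contribute to a sum of
differences. -/
lemma sum_ends_eq_sum_outgoing {S : Finset E} {j : V} (g : V × E → ℝ)
    (hg : ∀ x, (G.support S).Reachable j x.1 → g x = 0) :
    ∑ x : V × E with G.ends x.2 = s(j, x.1), g x = ∑ x ∈ G.outgoing S j, g x := by
  symm
  refine Finset.sum_subset (fun x hx => ?_) fun x hx hx' => hg x ?_
  · simpa using (mem_outgoing.1 hx).1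
  · by_contra h
    exact hx' (mem_outgoing.2 ⟨by simpa using hx, h⟩)

variable [DecidableEq E]

/-- A sum over all forests, arranged by the forest that remains when `j` is made a root. -/
lemma sum_forests (f : Finset E × Finset V → ℝ) (j : V) :
    ∑ p ∈ G.forests, f p = ∑ p ∈ G.forests with j ∈ p.2,
      (f p + ∑ x ∈ G.outgoing p.1 j, f (insert x.2 p.1, p.2.erase j)) := by
  rw [← Finset.sum_filter_add_sum_filter_not G.forests (fun p => j ∈ p.2),
    Finset.sum_add_distrib]
  congr 1
  symm
  rw [Finset.sum_sigma']
  refine Finset.sum_bij (fun y _ => (insert y.2.2 y.1.1, y.1.2.erase j)) ?_ ?_ ?_ ?_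
  · rintro ⟨⟨S, R⟩, m, e⟩ hy
    simp only [Finset.mem_sigma, Finset.mem_filter, mem_forests, mem_outgoing] at hy ⊢
    exact ⟨hy.1.1.insert_erase hy.1.2 hy.2.1 hy.2.2, Finset.notMem_erase _ _⟩
  · rintro ⟨⟨S, R⟩, m, e⟩ hy ⟨⟨S', R'⟩, m', e'⟩ hy' heq
    simp only [Finset.mem_sigma, Finset.mem_filter, mem_forests, mem_outgoing] at hy hy'
    simp only [Prod.mk.injEq] at heq
    obtain ⟨rfl, rfl, rfl, rfl⟩ := hy.1.1.insert_erase_injective hy'.1.1 hy.1.2 hy'.1.2 hy.2.1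
      hy'.2.1 hy.2.2 hy'.2.2 heq.1 heq.2
    rfl
  · rintro ⟨S, R⟩ hp
    simp only [Finset.mem_filter, mem_forests] at hp
    obtain ⟨e, m, he, hends, hF, hm⟩ := hp.1.exists_eq_insert_erase hp.2
    refine ⟨⟨(S.erase e, insert j R), m, e⟩, ?_, ?_⟩
    · simp only [Finset.mem_sigma, Finset.mem_filter, mem_forests, mem_outgoing]
      exact ⟨⟨hF, Finset.mem_insert_self _ _⟩, hends, hm⟩
    · simp only [Finset.insert_erase he, Finset.erase_insert hp.2]
  · intro y _
    rfl

-- Attachment changes the root only for vertices in the tree of `j`, which take over the root of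
-- `x.1`.
open scoped Classical in
lemma treeIndicator_attach {p : Finset E × Finset V} (hp : G.IsRootedForest p.1 p.2) {i j k : V}
    (hj : j ∈ p.2) {x : V × E} (hx : x ∈ G.outgoing p.1 j) :
    G.treeIndicator (insert x.2 p.1, p.2.erase j) i k =
      if (G.support p.1).Reachable j k then G.treeIndicator p i x.1
      else G.treeIndicator p i k := by
  rw [mem_outgoing] at hx
  have h := hp.mem_erase_and_reachable_insert_iff (i := i) (k := k) hj hx.1 hx.2
  simp only [treeIndicator, h]
  by_cases hk : (G.support p.1).Reachable j k <;> simp [hk]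

/-- The total weight of the forests in which `k` belongs to the tree rooted at `i`. -/
noncomputable def accessibleWeight (G : WeightedMultigraph V E) (i k : V) : ℝ :=
  ∑ p ∈ G.forests, (∏ e ∈ p.1, G.weight e) * G.treeIndicator p i k

/-- This is entry `(i, j)` of `A * (1 + L) = σ • 1`, with the Laplacian written edge by edge. The
equality already holds within each group of forests sharing the same detached forest `p`. -/
lemma sum_forests_laplacian (i j : V) :
    ∑ p ∈ G.forests, (∏ e ∈ p.1, G.weight e) * (G.treeIndicator p i j +
      ∑ x : V × E with G.ends x.2 = s(j, x.1),
        G.weight x.2 * (G.treeIndicator p i j - G.treeIndicator p i x.1)) =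
    if i = j then ∑ p ∈ G.forests, ∏ e ∈ p.1, G.weight e else 0 := by
  have hδ : (if i = j then ∑ p ∈ G.forests, ∏ e ∈ p.1, G.weight e else 0) =
      ∑ p ∈ G.forests, (∏ e ∈ p.1, G.weight e) * (if i = j then (1 : ℝ) else 0) := by
    split_ifs <;> simp
  rw [hδ, sum_forests _ j, sum_forests _ j]
  refine Finset.sum_congr rfl fun p hp => ?_
  rw [Finset.mem_filter, mem_forests] at hp
  obtain ⟨hp, hj⟩ := hp
  have hprod : ∀ y ∈ G.outgoing p.1 j,
      ∏ e ∈ insert y.2 p.1, G.weight e = G.weight y.2 * ∏ e ∈ p.1, G.weight e := by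
    intro y hy
    rw [mem_outgoing] at hy
    exact Finset.prod_insert fun h => hy.2 (support_adj_of_mem h hy.1).reachable
  have hbase : ∑ x : V × E with G.ends x.2 = s(j, x.1),
        G.weight x.2 * (G.treeIndicator p i j - G.treeIndicator p i x.1) =
      ∑ x ∈ G.outgoing p.1 j,
        G.weight x.2 * (G.treeIndicator p i j - G.treeIndicator p i x.1) :=
    sum_ends_eq_sum_outgoing _ fun x hx => by rw [treeIndicator_congr hx, sub_self, mul_zero]
  have hattach : ∀ y ∈ G.outgoing p.1 j, ∑ x : V × E with G.ends x.2 = s(j, x.1),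
        G.weight x.2 * (G.treeIndicator (insert y.2 p.1, p.2.erase j) i j -
          G.treeIndicator (insert y.2 p.1, p.2.erase j) i x.1) =
      ∑ x ∈ G.outgoing p.1 j,
        G.weight x.2 * (G.treeIndicator p i y.1 - G.treeIndicator p i x.1) := by
    intro y hy
    rw [sum_ends_eq_sum_outgoing (S := p.1)]
    · refine Finset.sum_congr rfl fun x hx => ?_
      rw [treeIndicator_attach hp hj hy, treeIndicator_attach hp hj hy,
        if_pos (SimpleGraph.Reachable.refl _), if_neg (mem_outgoing.1 hx).2]
    · intro x hx
      rw [treeIndicator_attach hp hj hy, treeIndicator_attach hp hj hy,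
        if_pos (SimpleGraph.Reachable.refl _), if_pos hx, sub_self, mul_zero]
  -- After attachment along `y`, the vertex `j` has the root that `y.1` has in `p`.
  have hself : ∀ y ∈ G.outgoing p.1 j,
      G.treeIndicator (insert y.2 p.1, p.2.erase j) i j = G.treeIndicator p i y.1 := by
    intro y hy
    rw [treeIndicator_attach hp hj hy, if_pos (SimpleGraph.Reachable.refl _)]
  -- The summand changes sign when `x` and `y` are exchanged.
  have hcancel : ∑ y ∈ G.outgoing p.1 j, ∑ x ∈ G.outgoing p.1 j, G.weight y.2 *
      (G.weight x.2 * (G.treeIndicator p i y.1 - G.treeIndicator p i x.1)) = 0 := by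
    simp only [mul_sub, Finset.sum_sub_distrib]
    rw [sub_eq_zero, Finset.sum_comm]
    exact Finset.sum_congr rfl fun x _ => Finset.sum_congr rfl fun y _ => by ring
  have hsum : ∑ y ∈ G.outgoing p.1 j, (∏ e ∈ insert y.2 p.1, G.weight e) *
        (G.treeIndicator (insert y.2 p.1, p.2.erase j) i j +
          ∑ x : V × E with G.ends x.2 = s(j, x.1),
            G.weight x.2 * (G.treeIndicator (insert y.2 p.1, p.2.erase j) i j -
              G.treeIndicator (insert y.2 p.1, p.2.erase j) i x.1)) =
      (∏ e ∈ p.1, G.weight e) *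
        ∑ y ∈ G.outgoing p.1 j, G.weight y.2 * G.treeIndicator p i y.1 := by
    -- Adding the vanishing double sum makes both sides sums over `y` that agree term by term.
    rw [← add_zero (∑ y ∈ G.outgoing p.1 j, G.weight y.2 * G.treeIndicator p i y.1), ← hcancel,
      ← Finset.sum_add_distrib, Finset.mul_sum]
    refine Finset.sum_congr rfl fun y hy => ?_
    rw [hprod y hy, hattach y hy, hself y hy, ← Finset.mul_sum]
    ring
  rw [hsum, hbase, treeIndicator_root hp hj, ← Finset.sum_mul, Finset.sum_congr rfl hprod]
  simp only [mul_sub, Finset.sum_sub_distrib, ← Finset.sum_mul]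
  ring

end ForestSums

/-! ### The matrix forest theorem and the probabilities. -/

section MatrixForest

variable {V E : Type*} [DecidableEq V] [Fintype E] {G : WeightedMultigraph V E}

lemma edgeWeight_comm (i j : V) : G.edgeWeight i j = G.edgeWeight j i := by
  rw [edgeWeight, edgeWeight, Sym2.eq_swap]

variable [Fintype V]

lemma laplacian_scale (α : ℝ) (hα : 0 < α) : (G.scale α hα).laplacian = α • G.laplacian := by
  have h : ∀ i j, (G.scale α hα).edgeWeight i j = α * G.edgeWeight i j := fun i j =>
    (Finset.mul_sum _ _ _).symm
  ext i j
  by_cases hij : i = j <;> simp [laplacian, hij, h, ← Finset.mul_sum, mul_sub]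

/-- Column `j` of the Laplacian sums to zero, so only differences with `f j` appear. Indexing by
pairs of an end and an edge counts parallel edges separately. -/
lemma sum_mul_laplacian (f : V → ℝ) (j : V) :
    ∑ k, f k * G.laplacian k j =
      ∑ x : V × E with G.ends x.2 = s(j, x.1), G.weight x.2 * (f j - f x.1) := by
  have hR : ∑ x : V × E with G.ends x.2 = s(j, x.1), G.weight x.2 * (f j - f x.1) =
      ∑ k, G.edgeWeight j k * (f j - f k) := by
    rw [Finset.sum_filter, Fintype.sum_prod_type]
    refine Finset.sum_congr rfl fun k _ => ?_
    rw [edgeWeight, Finset.sum_mul, Finset.sum_filter]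
  rw [hR, ← Finset.add_sum_erase _ _ (Finset.mem_univ j),
    ← Finset.add_sum_erase _ (fun k => G.edgeWeight j k * (f j - f k)) (Finset.mem_univ j)]
  have hdiag : G.laplacian j j = ∑ k ∈ Finset.univ.erase j, G.edgeWeight j k := by
    simp [laplacian]
  have hoff : ∀ k ∈ Finset.univ.erase j, f k * G.laplacian k j = -(G.edgeWeight j k * f k) := by
    intro k hk
    have hkj : k ≠ j := Finset.ne_of_mem_erase hk
    simp [laplacian, hkj, edgeWeight_comm k j, mul_comm]
  rw [Finset.sum_congr rfl hoff, hdiag]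
  simp only [mul_sub, Finset.sum_sub_distrib, ← Finset.sum_mul, Finset.sum_neg_distrib]
  ring

lemma accessibleWeight_mul_one_add_laplacian :
    Matrix.of G.accessibleWeight * (1 + G.laplacian) =
      (∑ p ∈ G.forests, ∏ e ∈ p.1, G.weight e) • (1 : Matrix V V ℝ) := by
  classical
  ext i j
  rw [mul_add, mul_one, Matrix.add_apply, Matrix.mul_apply]
  simp only [Matrix.of_apply]
  rw [sum_mul_laplacian]
  have h := sum_forests_laplacian (G := G) i j
  rw [Matrix.smul_apply, Matrix.one_apply, smul_eq_mul, mul_ite, mul_one, mul_zero, ← h]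
  simp only [accessibleWeight, mul_add, Finset.sum_add_distrib]
  congr 1
  simp only [← Finset.sum_sub_distrib, Finset.mul_sum]
  rw [Finset.sum_comm]
  refine Finset.sum_congr rfl fun p _ => Finset.sum_congr rfl fun x _ => ?_
  ring

/-- The matrix forest theorem. -/
lemma accessibility_apply (α : ℝ) (hα : 0 < α) (i j : V) :
    G.accessibility α i j = (G.scale α hα).accessibleWeight i j /
      ∑ F : (G.scale α hα).SpanningRootedForest, F.weight := by
  have hpos := sum_weight_pos (G := G.scale α hα)
  have h := accessibleWeight_mul_one_add_laplacian (G := G.scale α hα)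
  rw [← sum_weight_eq, laplacian_scale] at h
  have hinv : ((∑ F : (G.scale α hα).SpanningRootedForest, F.weight)⁻¹ •
      Matrix.of (G.scale α hα).accessibleWeight) * (1 + α • G.laplacian) = 1 := by
    rw [Matrix.smul_mul, h, smul_smul, inv_mul_cancel₀ hpos.ne', one_smul]
  rw [accessibility, Matrix.inv_eq_left_inv hinv]
  simp [div_eq_inv_mul]

-- When `i` is a root it lies in its own tree, so the two tree indicators differ exactly on the
-- unsuccessful forests.
open scoped Classical in
lemma sum_isUnsuccessful (i j : V) :
    ∑ F : G.SpanningRootedForest, (if F.IsUnsuccessful i j then F.weight else 0) =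
      G.accessibleWeight i i - G.accessibleWeight i j := by
  rw [accessibleWeight, accessibleWeight, ← Finset.sum_sub_distrib, ← sum_spanningRootedForest]
  refine Finset.sum_congr rfl fun F _ => ?_
  simp only [SpanningRootedForest.IsUnsuccessful, treeIndicator, SpanningRootedForest.weight]
  by_cases hi : i ∈ F.roots <;> by_cases hr : (G.support F.edges).Reachable i j <;> simp [hi, hr]

lemma toReal_toOuterMeasure_randomForest_isUnsuccessful (i j : V) :
    (G.randomForest.toOuterMeasure {F | F.IsUnsuccessful i j}).toReal =
      (G.accessibleWeight i i - G.accessibleWeight i j) /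
        ∑ F : G.SpanningRootedForest, F.weight := by
  classical
  have hpos := sum_weight_pos (G := G)
  rw [PMF.toOuterMeasure_apply_fintype, ENNReal.toReal_sum, ← sum_isUnsuccessful, Finset.sum_div]
  · refine Finset.sum_congr rfl fun F _ => ?_
    by_cases hF : F.IsUnsuccessful i j
    · simp [Set.indicator, hF, randomForest, (div_pos F.weight_pos hpos).le]
    · simp [Set.indicator, hF]
  · intro F _
    by_cases hF : F.IsUnsuccessful i j
    · simp [Set.indicator, hF, randomForest]
    · simp [Set.indicator, hF]

end MatrixForest

end WeightedMultigraph

theorem proposition5 {V E : Type*} [Fintype V] [DecidableEq V] [Fintype E]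
    (G : WeightedMultigraph V E) (α : ℝ) (hα : 0 < α) (i j : V) :
    G.forestDist α i j = (G.scale α hα).probUnsuccessful i j := by
  rw [WeightedMultigraph.probUnsuccessful_eq,
    WeightedMultigraph.toReal_toOuterMeasure_randomForest_isUnsuccessful,
    WeightedMultigraph.toReal_toOuterMeasure_randomForest_isUnsuccessful,
    WeightedMultigraph.forestDist]
  simp only [WeightedMultigraph.accessibility_apply α hα]
  ring
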